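/- All digraphs are finite and may have loops and multiple edges. A digraph is simple if it has no loops and, for all vertices $x,y$, at most one edge from $x$ to $y$ (a pair of opposite edges is allowed). It is Eulerian if every vertex has equal indegree and outdegree; this common value is the degree of the vertex. A digraph $F$ is strongly $r$-edge-connected if $F-S$ is strongly connected for every $S\subseteq E(F)$ with $|S|<r$. A digraph $D$ immerses a digraph $F$ if there are an injective map $\varphi:V(F)\to V(D)$ and a collection of pairwise edge-disjoint directed paths of positive length in $D$, one from $\varphi(u)$ to $\varphi(v)$ for every edge $uv$ of $F$ (for a loop, a directed cycle through $\varphi(u)$). Theorem. Let $r\ge 1$ be an integer and let $D$ be a nonempty simple Eulerian digraph with minimum degree at least $r$. Then $D$ immerses a strongly $r$-edge-connected Eulerian digraph $F$ with $|V(F)|>r$ such that $F-S$ is simple for some set $S\subseteq E(F)$ with $|S|<r$. -/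

import Mathlib

universe u v

/-- A directed graph with vertex set `V` and edge set `E`; loops and multiple edges are allowed.
Finiteness is imposed separately, by `Finite V` and `Finite E`. -/
structure MultiDigraph (V : Type*) (E : Type*) where
  /-- the initial vertex of an edge -/
  src : E → V
  /-- the terminal vertex of an edge -/
  tgt : E → V

namespace MultiDigraph

variable {V E W A : Type*}

/-- A digraph is simple if it has no loops and, for all `x` and `y`, at most one edge from `x`
to `y`. Oppositely oriented edges between two vertices are allowed. -/
def IsSimple (D : MultiDigraph V E) : Prop :=
  (∀ e, D.src e ≠ D.tgt e) ∧ ∀ e f, D.src e = D.src f → D.tgt e = D.tgt f → e = f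

/-- The number of edges leaving `v` (a loop counts once). -/
noncomputable def outDegree (D : MultiDigraph V E) (v : V) : ℕ :=
  Nat.card {e : E // D.src e = v}

/-- The number of edges entering `v` (a loop counts once). -/
noncomputable def inDegree (D : MultiDigraph V E) (v : V) : ℕ :=
  Nat.card {e : E // D.tgt e = v}

/-- Every vertex has equal indegree and outdegree. Connectedness is not part of the definition. -/
def IsEulerian (D : MultiDigraph V E) : Prop :=
  ∀ v, D.inDegree v = D.outDegree v

/-- `D.IsWalk u p v`: the list of edges `p` is a directed walk from `u` to `v`. -/
def IsWalk (D : MultiDigraph V E) : V → List E → V → Prop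
  | u, [], v => u = v
  | u, e :: p, v => D.src e = u ∧ D.IsWalk (D.tgt e) p v

/-- `D.IsDirPath u p v`: the list of edges `p` is a directed path with at least one edge from `u`
to `v`. All initial vertices of the edges of `p` are distinct, and so are all terminal vertices.
Hence for `u ≠ v` no vertex is repeated, and for `u = v` (needed for the loops of an immersed
digraph) `p` is a directed cycle through `u`. -/
def IsDirPath (D : MultiDigraph V E) (u : V) (p : List E) (v : V) : Prop :=
  p ≠ [] ∧ D.IsWalk u p v ∧ (p.map D.src).Nodup ∧ (p.map D.tgt).Nodup

/-- There is a directed walk from every vertex to every other. -/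
def StronglyConnected (D : MultiDigraph V E) : Prop :=
  ∀ u v, ∃ p, D.IsWalk u p v

/-- The digraph `D - S`, on the same vertex set. -/
def deleteEdges (D : MultiDigraph V E) (S : Finset E) : MultiDigraph V {e : E // e ∉ S} where
  src e := D.src e
  tgt e := D.tgt e

/-- `D - S` is strongly connected for every set `S` of fewer than `k` edges. -/
def StronglyEdgeConnected (D : MultiDigraph V E) (k : ℕ) : Prop :=
  ∀ S : Finset E, S.card < k → (D.deleteEdges S).StronglyConnected

/-- `D.Immerses F`: there are an injective map `φ` from the vertices of `F` to those of `D` and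
pairwise edge-disjoint directed paths in `D`, one from `φ x` to `φ y` for every edge of `F`
from `x` to `y`. -/
def Immerses (D : MultiDigraph V E) (F : MultiDigraph W A) : Prop :=
  ∃ (φ : W → V) (P : A → List E), Function.Injective φ ∧
    (∀ a, D.IsDirPath (φ (F.src a)) (P a) (φ (F.tgt a))) ∧
    Pairwise fun a b => (P a).Disjoint (P b)

end MultiDigraph

/-!
For a set `Y` of vertices let `d(Y)` be the number of edges leaving `Y`. In an Eulerian digraph `d`
is symmetric under complementation and submodular, hence both `d(Y ∩ Z) + d(Y ∪ Z)` and
`d(Y \ Z) + d(Z \ Y)` are at most `d(Y) + d(Z)`. Everything rests on these two inequalities.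

* Some nonempty `X` with `d(X) < r` is not separated by any `Y` with `d(Y) < r`
  (`exists_inseparable`). If there are no cuts of size less than `r`, this is the whole vertex set;
  otherwise uncrossing shows that a smallest set among the minimum cuts of size less than `r` has
  this property. It plays the role of a leaf of a Gomory–Hu tree in which the edges of capacity at
  least `r` have been contracted.
* As `D` is simple with degrees at least `r`, counting the edges that start in `X` gives `r < |X|`
  (`lt_card_of_cutSize_lt`).
* The vertices outside `X` are removed by splitting off: an edge `uv` and an edge `vw` with `v ∉ X`
  are replaced by an edge `uw`, such that every set separating `X` still has at least `r` leaving
  edges (`exists_splittable`). If no edge `vw` is admissible for `uv`, then every `w` lies together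
  with `u` in a tight set avoiding `v`; these tight sets are closed under union, and adding `v` to
  their union yields a separating set with fewer than `r` leaving edges.

When no edge meets the complement of `X`, the remaining digraph `F` on `X` is strongly
`r`-edge-connected. Each of its edges is realized by a walk of `D`, and those that are not edges of
`D` start with different edges leaving `X`, so that there are at most `d(X) < r` of them.
-/

open Finset

namespace MultiDigraph

variable {V E : Type*}

/-! ### Walks and paths -/

theorem IsWalk.append {D : MultiDigraph V E} {p q : List E} {u v w : V}
    (hp : D.IsWalk u p v) (hq : D.IsWalk v q w) : D.IsWalk u (p ++ q) w := by
  induction p generalizing u with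
  | nil => obtain rfl : u = v := hp; exact hq
  | cons e p ih => exact ⟨hp.1, ih hp.2⟩

theorem IsWalk.of_append_right {D : MultiDigraph V E} {p q : List E} {e : E} {u w : V}
    (h : D.IsWalk u (p ++ e :: q) w) : D.IsWalk (D.tgt e) q w := by
  induction p generalizing u with
  | nil => exact h.2
  | cons f p ih => exact ih h.2

theorem IsWalk.mem_map_src {D : MultiDigraph V E} {p : List E} {u v x : V}
    (h : D.IsWalk u p v) (hx : x ∈ p.map D.src) : x = u ∨ x ∈ p.map D.tgt := by
  induction p generalizing u with
  | nil => simp at hx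
  | cons e p ih =>
    rw [List.map_cons, List.mem_cons] at hx ⊢
    rcases hx with rfl | hx
    · exact Or.inl h.1
    · exact Or.inr (ih h.2 hx)

/-- The conditions on `u` and `v` exclude closed subwalks at the ends; they carry the induction. -/
theorem IsWalk.exists_nodup {D : MultiDigraph V E} {p : List E} {u v : V} (h : D.IsWalk u p v) :
    ∃ q, q ⊆ p ∧ D.IsWalk u q v ∧ (q.map D.src).Nodup ∧ (q.map D.tgt).Nodup ∧
      v ∉ q.map D.src ∧ u ∉ q.map D.tgt := by
  induction p generalizing u with
  | nil => exact ⟨[], by simp, h, by simp, by simp, by simp, by simp⟩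
  | cons e p ih =>
    obtain ⟨q, hqp, hq, hs, ht, hv, hu⟩ := ih h.2
    have hqp' : q ⊆ e :: p := fun x hx => List.mem_cons_of_mem _ (hqp hx)
    by_cases huv : u = v
    · subst huv
      exact ⟨[], by simp, rfl, by simp, by simp, by simp, by simp⟩
    by_cases hue : u = D.tgt e
    · subst hue
      exact ⟨q, hqp', hq, hs, ht, hv, hu⟩
    by_cases huq : u ∈ q.map D.tgt
    · obtain ⟨g, hg, rfl⟩ := List.mem_map.1 huq
      obtain ⟨l₁, l₂, rfl⟩ := List.append_of_mem hg
      simp only [List.map_append, List.map_cons, List.nodup_append, List.nodup_cons,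
        List.mem_append, List.mem_cons, not_or] at hs ht hv
      exact ⟨l₂, fun x hx => hqp' (by simp [hx]), hq.of_append_right, hs.2.1.2, ht.2.1.2,
        hv.2.2, ht.2.1.1⟩
    · refine ⟨e :: q, ?_, ⟨h.1, hq⟩, ?_, ?_, ?_, ?_⟩
      · exact List.cons_subset_cons _ hqp
      · rw [List.map_cons, List.nodup_cons, h.1]
        exact ⟨fun hx => (hq.mem_map_src hx).elim hue huq, hs⟩
      · rw [List.map_cons, List.nodup_cons]
        exact ⟨hu, ht⟩
      · rw [List.map_cons, List.mem_cons, not_or, h.1]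
        exact ⟨fun hx => huv hx.symm, hv⟩
      · rw [List.map_cons, List.mem_cons, not_or]
        exact ⟨hue, huq⟩

theorem IsWalk.exists_isDirPath {D : MultiDigraph V E} {p : List E} {u v : V}
    (h : D.IsWalk u p v) (huv : u ≠ v) : ∃ q, q ⊆ p ∧ D.IsDirPath u q v := by
  obtain ⟨q, hqp, hq, hs, ht, -, -⟩ := h.exists_nodup
  refine ⟨q, hqp, ?_, hq, hs, ht⟩
  rintro rfl
  exact huv hq

/-! ### Cuts in Eulerian digraphs -/

theorem card_filter_eq_add_of_mem_of_mem [DecidableEq E] {A : Finset E} {e f : E}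
    (he : e ∈ A) (hf : f ∈ A) (hef : e ≠ f) (p : E → Prop) [DecidablePred p] :
    #{g ∈ A | p g} =
      #{g ∈ (A.erase f).erase e | p g} + (if p e then 1 else 0) + (if p f then 1 else 0) := by
  simp only [card_filter]
  rw [← sum_erase_add A _ hf, ← sum_erase_add (A.erase f) _ (mem_erase.2 ⟨hef, he⟩)]

/-- Counting the edges after `e` and `f` have been replaced by one edge, which is again called
`e`. -/
theorem card_filter_erase_eq_add [DecidableEq E] {A : Finset E} {e f : E} (he : e ∈ A)
    (hef : e ≠ f) (t : E → V) (w : V) (p : E → V → Prop) [∀ g x, Decidable (p g x)] :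
    #{g ∈ A.erase f | p g (Function.update t e w g)} =
      #{g ∈ (A.erase f).erase e | p g (t g)} + (if p e w then 1 else 0) := by
  simp only [card_filter]
  rw [← sum_erase_add (A.erase f) _ (mem_erase.2 ⟨hef, he⟩)]
  congr 1
  · refine sum_congr rfl fun g hg => ?_
    rw [Function.update_of_ne (ne_of_mem_erase hg)]
  · rw [Function.update_self]

section Cut

variable [DecidableEq V]

/-- The number of edges leaving `Y` in the digraph with edge set `A`, where an edge `e` goes from
`s e` to `t e`. -/
def cutSize (s t : E → V) (A : Finset E) (Y : Finset V) : ℕ :=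
  #{e ∈ A | s e ∈ Y ∧ t e ∉ Y}

/-- The digraph with edge set `A`, where `e` goes from `s e` to `t e`, is Eulerian. -/
def Balanced (s t : E → V) (A : Finset E) : Prop :=
  ∀ v, #{e ∈ A | t e = v} = #{e ∈ A | s e = v}

/-- `Y` separates `X`: it contains some but not all of the elements of `X`. -/
def Separates (Y X : Finset V) : Prop :=
  (∃ a ∈ X, a ∈ Y) ∧ ∃ b ∈ X, b ∉ Y

theorem card_filter_mem_eq_sum (s : E → V) (A : Finset E) (Y : Finset V) :
    #{e ∈ A | s e ∈ Y} = ∑ v ∈ Y, #{e ∈ A | s e = v} := by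
  rw [card_eq_sum_card_fiberwise (s := {e ∈ A | s e ∈ Y}) (f := s) (t := Y)
    (fun e he => (mem_filter.1 (mem_coe.1 he)).2)]
  refine sum_congr rfl fun v hv => ?_
  rw [filter_filter]
  refine congrArg card (filter_congr fun e _ => ?_)
  exact ⟨fun h => h.2, fun h => ⟨h ▸ hv, h⟩⟩

theorem cutSize_add_card_filter (s t : E → V) (A : Finset E) (Y : Finset V) :
    cutSize s t A Y + #{e ∈ A | s e ∈ Y ∧ t e ∈ Y} = #{e ∈ A | s e ∈ Y} := by
  rw [← card_filter_add_card_filter_not (s := {e ∈ A | s e ∈ Y}) (fun e => t e ∈ Y),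
    filter_filter, filter_filter, add_comm, cutSize]

theorem Balanced.cutSize_compl [Fintype V] {s t : E → V} {A : Finset E} (h : Balanced s t A)
    (Y : Finset V) : cutSize s t A Yᶜ = cutSize s t A Y := by
  have h₁ := cutSize_add_card_filter s t A Y
  have h₂ := cutSize_add_card_filter t s A Y
  have h₃ : #{e ∈ A | t e ∈ Y} = #{e ∈ A | s e ∈ Y} := by
    rw [card_filter_mem_eq_sum, card_filter_mem_eq_sum]
    exact sum_congr rfl fun v _ => h v
  have h₄ : cutSize t s A Y = cutSize s t A Yᶜ :=
    congrArg card (filter_congr fun e _ => by simp [and_comm])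
  have h₅ : #{e ∈ A | t e ∈ Y ∧ s e ∈ Y} = #{e ∈ A | s e ∈ Y ∧ t e ∈ Y} :=
    congrArg card (filter_congr fun e _ => and_comm)
  omega

theorem cutSize_inter_add_cutSize_union_le (s t : E → V) (A : Finset E) (Y Z : Finset V) :
    cutSize s t A (Y ∩ Z) + cutSize s t A (Y ∪ Z) ≤ cutSize s t A Y + cutSize s t A Z := by
  simp only [cutSize, card_filter, ← sum_add_distrib]
  refine sum_le_sum fun e _ => ?_
  by_cases h₁ : s e ∈ Y <;> by_cases h₂ : s e ∈ Z <;> by_cases h₃ : t e ∈ Y <;>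
    by_cases h₄ : t e ∈ Z <;> simp [h₁, h₂, h₃, h₄]

theorem cutSize_inter_add_cutSize_union_lt {s t : E → V} {A : Finset E} {Y Z : Finset V} {e : E}
    (he : e ∈ A) (h₁ : s e ∈ Y) (h₂ : s e ∉ Z) (h₃ : t e ∉ Y) (h₄ : t e ∈ Z) :
    cutSize s t A (Y ∩ Z) + cutSize s t A (Y ∪ Z) < cutSize s t A Y + cutSize s t A Z := by
  simp only [cutSize, card_filter, ← sum_add_distrib]
  refine sum_lt_sum (fun e _ => ?_) ⟨e, he, by simp [h₁, h₂, h₃, h₄]⟩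
  by_cases h₁ : s e ∈ Y <;> by_cases h₂ : s e ∈ Z <;> by_cases h₃ : t e ∈ Y <;>
    by_cases h₄ : t e ∈ Z <;> simp [h₁, h₂, h₃, h₄]

/-- Symmetry turns submodularity into an inequality for differences, which is strict if an edge
goes from `Y ∩ Z` to the complement of `Y ∪ Z`. -/
theorem Balanced.cutSize_sdiff_add_cutSize_sdiff_lt [Fintype V] {s t : E → V} {A : Finset E}
    (h : Balanced s t A) {Y Z : Finset V} {e : E} (he : e ∈ A) (h₁ : s e ∈ Y) (h₂ : s e ∈ Z)
    (h₃ : t e ∉ Y) (h₄ : t e ∉ Z) :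
    cutSize s t A (Y \ Z) + cutSize s t A (Z \ Y) < cutSize s t A Y + cutSize s t A Z := by
  have key := cutSize_inter_add_cutSize_union_lt (Z := Zᶜ) he h₁ (by simpa using h₂) h₃
    (by simpa using h₄)
  have hYZ : Y ∩ Zᶜ = Y \ Z := by ext; simp
  have hZY : (Y ∪ Zᶜ) = (Z \ Y)ᶜ := by ext; simp; tauto
  rwa [hYZ, hZY, h.cutSize_compl, h.cutSize_compl] at key

/-- A nonempty set with fewer than `r` leaving edges that is not separated by any such set. -/
theorem Balanced.exists_inseparable [Fintype V] [Nonempty V] {s t : E → V} {A : Finset E}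
    (h : Balanced s t A) {r : ℕ} (hr : 1 ≤ r) :
    ∃ X : Finset V, X.Nonempty ∧ cutSize s t A X < r ∧
      ∀ Y, Separates Y X → r ≤ cutSize s t A Y := by
  classical
  -- The candidates `Y` are minimum among the cuts between `Y` and some vertex `v`.
  let 𝒞 : Finset (Finset V) := {Y | Y.Nonempty ∧ cutSize s t A Y < r ∧
    ∃ v ∉ Y, ∀ Z, Y ⊆ Z → v ∉ Z → cutSize s t A Y ≤ cutSize s t A Z}
  -- A minimum cut among those separating `a` and `b`.
  have hmin : ∀ (a b : V) (Z : Finset V), a ∈ Z → b ∉ Z → ∃ M : Finset V, a ∈ M ∧ b ∉ M ∧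
      cutSize s t A M ≤ cutSize s t A Z ∧
      ∀ N : Finset V, a ∈ N → b ∉ N → cutSize s t A M ≤ cutSize s t A N := by
    intro a b Z ha hb
    obtain ⟨M, hM, hM'⟩ := exists_min_image ({N | a ∈ N ∧ b ∉ N} : Finset (Finset V))
      (cutSize s t A) ⟨Z, by simp [ha, hb]⟩
    simp only [mem_filter, mem_univ, true_and] at hM hM'
    exact ⟨M, hM.1, hM.2, hM' Z ⟨ha, hb⟩, fun N h₁ h₂ => hM' N ⟨h₁, h₂⟩⟩
  rcases 𝒞.eq_empty_or_nonempty with h𝒞 | h𝒞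
  · refine ⟨univ, univ_nonempty, ?_, ?_⟩
    · simp only [cutSize, mem_univ, not_true_eq_false, and_false, filter_false, card_empty]
      omega
    · rintro Y ⟨⟨a, -, ha⟩, b, -, hb⟩
      by_contra! hlt
      obtain ⟨M, haM, hbM, hMY, hM⟩ := hmin a b Y ha hb
      have : M ∈ 𝒞 := by
        simp only [𝒞, mem_filter, mem_univ, true_and]
        exact ⟨⟨a, haM⟩, by omega, b, hbM, fun Z hZ hb => hM Z (hZ haM) hb⟩
      simp [h𝒞] at this
  · obtain ⟨X, hX, hXmin⟩ := exists_min_image 𝒞 card h𝒞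
    simp only [𝒞, mem_filter, mem_univ, true_and] at hX hXmin
    obtain ⟨hne, hXr, v, hvX, hv⟩ := hX
    refine ⟨X, hne, hXr, ?_⟩
    -- A small cut separating `X` and avoiding `v` would yield a smaller candidate by uncrossing.
    have key : ∀ a ∈ X, ∀ b ∈ X, ∀ M : Finset V, a ∈ M → b ∉ M → v ∉ M →
        cutSize s t A M < r →
        (∀ N : Finset V, a ∈ N → b ∉ N → cutSize s t A M ≤ cutSize s t A N) → False := by
      intro a haX b hbX M haM hbM hvM hMr hM
      have hunion := hv (X ∪ M) subset_union_left (by simp [hvX, hvM])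
      have hsub := cutSize_inter_add_cutSize_union_le s t A X M
      have hcard := hXmin (X ∩ M) ⟨⟨a, by simp [haX, haM]⟩, by omega, b, by simp [hbM],
        fun Z hZ hb => by
          have := hM Z (hZ (by simp [haX, haM])) hb
          omega⟩
      have : X ∩ M ⊂ X := by
        rw [ssubset_iff_of_subset inter_subset_left]
        exact ⟨b, hbX, by simp [hbM]⟩
      exact absurd (card_lt_card this) (by omega)
    rintro Y ⟨⟨a, haX, haY⟩, b, hbX, hbY⟩
    by_contra! hlt
    obtain ⟨M, haM, hbM, hMY, hM⟩ := hmin a b Y haY hbY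
    by_cases hvM : v ∈ M
    · refine key b hbX a haX Mᶜ (by simpa using hbM) (by simpa using haM) (by simpa using hvM)
        (by rw [h.cutSize_compl]; omega) fun N hbN haN => ?_
      rw [h.cutSize_compl, ← h.cutSize_compl N]
      exact hM _ (by simpa using haN) (by simpa using hbN)
    · exact key a haX b hbX M haM hbM hvM (by omega) hM

/-- If all degrees are at least `r` and fewer than `r` edges leave `X`, then `X` is large: at most
`|X| (|X| - 1)` of the edges starting in `X` end in `X`. -/
theorem lt_card_of_cutSize_lt [Fintype E] {D : MultiDigraph V E} (hD : D.IsSimple) {r : ℕ}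
    (hdeg : ∀ v, r ≤ #{e | D.src e = v}) {X : Finset V} (hne : X.Nonempty)
    (hX : cutSize D.src D.tgt univ X < r) : r < #X := by
  have h₁ : #X * r ≤ #{e | D.src e ∈ X} := by
    rw [card_filter_mem_eq_sum, ← smul_eq_mul]
    exact card_nsmul_le_sum _ _ _ fun v _ => hdeg v
  have h₂ := cutSize_add_card_filter D.src D.tgt univ X
  have h₃ : #{e | D.src e ∈ X ∧ D.tgt e ∈ X} ≤ #X * #X - #X := by
    rw [← offDiag_card]
    refine card_le_card_of_injOn (fun e => (D.src e, D.tgt e)) ?_ ?_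
    · intro e he
      simp only [coe_filter, mem_univ, true_and, Set.mem_ofPred_eq] at he
      simpa using ⟨he.1, he.2, hD.1 e⟩
    · intro e _ f _ hef
      exact hD.2 e f (congrArg Prod.fst hef) (congrArg Prod.snd hef)
  have hpos : 1 ≤ #X := hne.card_pos
  obtain ⟨n, hn⟩ := Nat.exists_eq_add_of_le' hpos
  rw [hn] at h₁ h₃ ⊢
  have h₄ : (n + 1) * (n + 1) - (n + 1) = (n + 1) * n := by
    rw [Nat.mul_succ, Nat.add_sub_cancel]
  by_contra! hle
  have h₅ : (n + 1) * n ≤ r * n := Nat.mul_le_mul_right n hle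
  have h₆ : (n + 1) * r = r * n + r := by ring
  omega

/-! ### Splitting off -/

/-- For an edge `e` ending at `v` outside `X`, some edge `f` starting at `v` is such that no set
with at most `r` leaving edges separates `X` and has both `s e` and `t f` on the opposite side
of `v`. -/
theorem Balanced.exists_splittable [Fintype V] {s t : E → V} {A : Finset E}
    (h : Balanced s t A) {r : ℕ} {X : Finset V}
    (hcut : ∀ Y, Separates Y X → r ≤ cutSize s t A Y) {e : E} (he : e ∈ A)
    (hv : t e ∉ X) :
    ∃ f ∈ A, s f = t e ∧ ∀ Y, Separates Y X → cutSize s t A Y ≤ r →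
      s e ∈ Y → t f ∈ Y → t e ∈ Y := by
  by_contra! hbad
  let O : Finset E := {f ∈ A | s f = t e}
  have hO : O.Nonempty := by
    rw [← card_pos, ← h (t e), card_pos]
    exact ⟨e, by simp [he]⟩
  have hbad' : ∀ f : O, ∃ Y : Finset V, Separates Y X ∧ cutSize s t A Y ≤ r ∧ s e ∈ Y ∧
      t f ∈ Y ∧ t e ∉ Y := fun f => hbad f (mem_filter.1 f.2).1 (mem_filter.1 f.2).2
  choose T hsep htight hsrc htgt hmid using hbad'
  let P : Finset V → Prop := fun Y =>
    Separates Y X ∧ cutSize s t A Y ≤ r ∧ s e ∈ Y ∧ t e ∉ Y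
  have hunion : ∀ Y, P Y → ∀ Z, P Z → P (Y ⊔ Z) := by
    rintro Y ⟨hY, hYr, hYu, hYv⟩ Z ⟨hZ, hZr, hZu, hZv⟩
    rw [sup_eq_union]
    by_cases hsep : Separates (Y ∩ Z) X ∧ Separates (Y ∪ Z) X
    · refine ⟨hsep.2, ?_, by simp [hYu], by simp [hYv, hZv]⟩
      have h₁ := hcut _ hsep.1
      have h₂ := cutSize_inter_add_cutSize_union_le s t A Y Z
      omega
    · exfalso
      obtain ⟨⟨a, haX, haY⟩, b, hbX, hbY⟩ := hY
      obtain ⟨⟨c, hcX, hcZ⟩, d, hdX, hdZ⟩ := hZ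
      -- Either `X` is disjoint from `Y ∩ Z` or it is contained in `Y ∪ Z`.
      have hsep' : Separates (Y \ Z) X ∧ Separates (Z \ Y) X := by
        by_cases hI : ∃ x ∈ X, x ∈ Y ∩ Z
        · have hU : ∀ x ∈ X, x ∈ Y ∪ Z := by
            by_contra! hU
            exact hsep ⟨⟨hI, b, hbX, by simp [hbY]⟩, ⟨a, haX, by simp [haY]⟩, hU⟩
          have hb := hU b hbX
          have hd := hU d hdX
          simp only [mem_union, hbY, hdZ, false_or, or_false] at hb hd
          exact ⟨⟨⟨d, hdX, by simp [hd, hdZ]⟩, b, hbX, by simp [hbY]⟩,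
            ⟨⟨b, hbX, by simp [hb, hbY]⟩, d, hdX, by simp [hdZ]⟩⟩
        · push Not at hI
          have ha := hI a haX
          have hc := hI c hcX
          simp only [mem_inter, haY, hcZ, true_and, and_true] at ha hc
          exact ⟨⟨⟨a, haX, by simp [haY, ha]⟩, c, hcX, by simp [hc]⟩,
            ⟨⟨c, hcX, by simp [hc, hcZ]⟩, a, haX, by simp [ha]⟩⟩
      have h₁ := hcut _ hsep'.1
      have h₂ := hcut _ hsep'.2
      have h₃ := h.cutSize_sdiff_add_cutSize_sdiff_lt he hYu hZu hYv hZv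
      omega
  have hO' : O.attach.Nonempty := hO.attach
  obtain ⟨⟨⟨a, haX, haU⟩, b, hbX, hbU⟩, hUr, hUu, hUv⟩ : P (O.attach.sup' hO' T) :=
    sup'_induction hO' T hunion fun f _ => ⟨hsep f, htight f, hsrc f, hmid f⟩
  set U := O.attach.sup' hO' T
  -- Every edge leaving `insert (t e) U` also leaves `U`, while `e` leaves only `U`.
  have hins := hcut (insert (t e) U) ⟨⟨a, haX, mem_insert_of_mem haU⟩, b, hbX, by
    rw [mem_insert, not_or]
    exact ⟨fun hb => hv (hb ▸ hbX), hbU⟩⟩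
  have hlt : cutSize s t A (insert (t e) U) < cutSize s t A U := by
    refine card_lt_card ((ssubset_iff_of_subset ?_).2 ⟨e, ?_, ?_⟩)
    · intro f hf
      simp only [mem_filter, mem_insert, not_or] at hf ⊢
      obtain ⟨hfA, hfs | hfs, -, hft⟩ := hf
      · have hfO : f ∈ O := mem_filter.2 ⟨hfA, hfs⟩
        exact absurd (le_sup' T (mem_attach O ⟨f, hfO⟩) (htgt ⟨f, hfO⟩)) hft
      · exact ⟨hfA, hfs, hft⟩
    · simp [he, hUu, hUv]
    · simp
  omega

section Split

variable [DecidableEq E]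

theorem Balanced.split {s t : E → V} {A : Finset E} (h : Balanced s t A) {e f : E} (he : e ∈ A)
    (hf : f ∈ A) (hef : e ≠ f) (hst : s f = t e) :
    Balanced s (Function.update t e (t f)) (A.erase f) := by
  intro v
  have h₀ := h v
  rw [card_filter_eq_add_of_mem_of_mem he hf hef (fun g => t g = v),
    card_filter_eq_add_of_mem_of_mem he hf hef (fun g => s g = v), hst] at h₀
  rw [card_filter_erase_eq_add he hef t (t f) (fun _ x => x = v),
    card_filter_erase_eq_add he hef t (t f) (fun g _ => s g = v)]
  omega

/-- Splitting off lowers the size of a cut by one if the middle vertex is on one side and the two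
other vertices are on the other side, and preserves it otherwise. -/
theorem le_cutSize_split {s t : E → V} {A : Finset E} {e f : E} (he : e ∈ A)
    (hf : f ∈ A) (hef : e ≠ f) (hst : s f = t e) {r : ℕ} {Y : Finset V}
    (hr : r ≤ cutSize s t A Y) (h₁ : cutSize s t A Y ≤ r → s e ∈ Y → t f ∈ Y → t e ∈ Y)
    (h₂ : cutSize s t A Y ≤ r → s e ∉ Y → t f ∉ Y → t e ∉ Y) :
    r ≤ cutSize s (Function.update t e (t f)) (A.erase f) Y := by
  have h₃ : cutSize s t A Y = _ :=
    card_filter_eq_add_of_mem_of_mem he hf hef (fun g => s g ∈ Y ∧ t g ∉ Y)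
  have h₄ : cutSize s (Function.update t e (t f)) (A.erase f) Y = _ :=
    card_filter_erase_eq_add he hef t (t f) (fun g x => s g ∈ Y ∧ x ∉ Y)
  rw [hst] at h₃
  by_cases ha : s e ∈ Y <;> by_cases hb : t e ∈ Y <;> by_cases hc : t f ∈ Y <;>
    simp only [ha, hb, hc, not_true_eq_false, not_false_eq_true, and_true, and_false, if_true,
      if_false, forall_true_left, false_imp_iff, imp_false, not_le] at h₁ h₂ h₃ h₄ <;> omega

end Split

/-- A digraph on the vertices of `D` all of whose edges are realized by edge-disjoint walks of `D`
and that still joins the vertices of `X` as required. Its edges are named by the first edges of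
their walks: `e ∈ A` goes from `D.src e` to `t e` and is realized by `P e`. -/
structure IsRouting (D : MultiDigraph V E) (X : Finset V) (r : ℕ) (A : Finset E) (t : E → V)
    (P : E → List E) : Prop where
  isWalk : ∀ e ∈ A, D.IsWalk (D.src e) (P e) (t e)
  disjoint : ∀ e ∈ A, ∀ f ∈ A, e ≠ f → (P e).Disjoint (P f)
  balanced : Balanced D.src t A
  le_cutSize : ∀ Y, Separates Y X → r ≤ cutSize D.src t A Y
  tgt_eq : ∀ e ∈ A, D.tgt e ∈ X → t e = D.tgt e

theorem IsRouting.erase_loop [DecidableEq E] {D : MultiDigraph V E} {X : Finset V} {r : ℕ}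
    {A : Finset E} {t : E → V} {P : E → List E} (h : IsRouting D X r A t P) {e : E} (he : e ∈ A)
    (hloop : D.src e = t e) : IsRouting D X r (A.erase e) t P where
  isWalk f hf := h.isWalk f (mem_of_mem_erase hf)
  disjoint f hf g hg := h.disjoint f (mem_of_mem_erase hf) g (mem_of_mem_erase hg)
  balanced v := by
    have h₀ := h.balanced v
    simp only [card_filter] at h₀ ⊢
    rw [← sum_erase_add A _ he, ← sum_erase_add A _ he, hloop] at h₀
    omega
  le_cutSize Y hY := by
    refine (h.le_cutSize Y hY).trans (card_le_card fun f hf => ?_)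
    simp only [mem_filter, mem_erase] at hf ⊢
    refine ⟨⟨?_, hf.1⟩, hf.2⟩
    rintro rfl
    exact hf.2.2 (hloop ▸ hf.2.1)
  tgt_eq f hf := h.tgt_eq f (mem_of_mem_erase hf)

theorem IsRouting.exists_split [Fintype V] [DecidableEq E] {D : MultiDigraph V E} {X : Finset V}
    {r : ℕ} {A : Finset E} {t : E → V} {P : E → List E} (h : IsRouting D X r A t P) {e : E}
    (he : e ∈ A) (hv : t e ∉ X) (hloop : D.src e ≠ t e) :
    ∃ f ∈ A, ∃ t' P', IsRouting D X r (A.erase f) t' P' := by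
  obtain ⟨f, hf, hst, hsplit⟩ := h.balanced.exists_splittable h.le_cutSize he hv
  have hef : e ≠ f := by
    rintro rfl
    exact hloop hst
  -- The realization of an edge other than `e` is disjoint from those of `e` and `f`.
  have hdisj : ∀ g ∈ A.erase f, g ≠ e → (P e ++ P f).Disjoint (P g) := fun g hg hge =>
    List.disjoint_append_left.2 ⟨h.disjoint e he g (mem_of_mem_erase hg) hge.symm,
      h.disjoint f hf g (mem_of_mem_erase hg) (ne_of_mem_erase hg).symm⟩
  refine ⟨f, hf, Function.update t e (t f), Function.update P e (P e ++ P f), ?_, ?_,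
    h.balanced.split he hf hef hst, ?_, ?_⟩
  · intro g hg
    by_cases hge : g = e
    · subst hge
      rw [Function.update_self, Function.update_self]
      exact (h.isWalk g he).append (hst ▸ h.isWalk f hf)
    · rw [Function.update_of_ne hge, Function.update_of_ne hge]
      exact h.isWalk g (mem_of_mem_erase hg)
  · intro g hg k hk hgk
    by_cases hge : g = e
    · subst hge
      rw [Function.update_self, Function.update_of_ne hgk.symm]
      exact hdisj k hk hgk.symm
    by_cases hke : k = e
    · subst hke
      rw [Function.update_self, Function.update_of_ne hgk]
      exact (hdisj g hg hgk).symm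
    rw [Function.update_of_ne hge, Function.update_of_ne hke]
    exact h.disjoint g (mem_of_mem_erase hg) k (mem_of_mem_erase hk) hgk
  · intro Y hY
    refine le_cutSize_split he hf hef hst (h.le_cutSize Y hY) (hsplit Y hY) ?_
    -- The other configuration is the first one for the complement of `Y`.
    intro hle hs ht
    have hY' : Separates Yᶜ X := by
      obtain ⟨⟨a, haX, haY⟩, b, hbX, hbY⟩ := hY
      exact ⟨⟨b, hbX, by simpa using hbY⟩, a, haX, by simpa using haY⟩
    simpa using hsplit Yᶜ hY' (by rwa [h.balanced.cutSize_compl]) (by simpa using hs)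
      (by simpa using ht)
  · intro g hg hgX
    have hge : g ≠ e := by
      rintro rfl
      exact hv (h.tgt_eq g he hgX ▸ hgX)
    rw [Function.update_of_ne hge]
    exact h.tgt_eq g (mem_of_mem_erase hg) hgX

/-- Repeated splitting off and removal of loops isolates all vertices outside `X`. -/
theorem IsRouting.exists_inside [Fintype V] {D : MultiDigraph V E} {X : Finset V}
    {r : ℕ} {A : Finset E} {t : E → V} {P : E → List E} (h : IsRouting D X r A t P) :
    ∃ A' t' P', IsRouting D X r A' t' P' ∧
      ∀ e ∈ A', D.src e ∈ X ∧ t' e ∈ X ∧ D.src e ≠ t' e := by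
  classical
  induction hn : #A using Nat.strong_induction_on generalizing A t P with
  | _ n ih =>
    by_cases hloop : ∃ e ∈ A, D.src e = t e
    · obtain ⟨e, he, hl⟩ := hloop
      exact ih _ (hn ▸ card_erase_lt_of_mem he) (h.erase_loop he hl) rfl
    push Not at hloop
    by_cases hout : ∃ e ∈ A, t e ∉ X
    · obtain ⟨e, he, hv⟩ := hout
      obtain ⟨f, hf, t', P', h'⟩ := h.exists_split he hv (hloop e he)
      exact ih _ (hn ▸ card_erase_lt_of_mem hf) h' rfl
    push Not at hout
    refine ⟨A, t, P, h, fun e he => ⟨?_, hout e he, hloop e he⟩⟩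
    -- The initial vertex of `e` is also the terminal vertex of some edge.
    have hpos : 0 < #{f ∈ A | t f = D.src e} := by
      rw [h.balanced, card_pos]
      exact ⟨e, by simp [he]⟩
    obtain ⟨f, hf⟩ := card_pos.1 hpos
    rw [mem_filter] at hf
    exact hf.2 ▸ hout f hf.1

end Cut

/-! ### The immersed digraph -/

theorem stronglyEdgeConnected_of_le_cutSize [Fintype V] [Fintype E] [DecidableEq V]
    {F : MultiDigraph V E} {r : ℕ}
    (h : ∀ Y : Finset V, Separates Y univ → r ≤ cutSize F.src F.tgt univ Y) :
    F.StronglyEdgeConnected r := by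
  classical
  intro S hS u v
  by_contra hv
  -- More edges leave the set of vertices reachable from `u` than have been deleted.
  let Y : Finset V := {x | ∃ p, (F.deleteEdges S).IsWalk u p x}
  have hY := h Y ⟨⟨u, mem_univ _, by simpa [Y] using ⟨[], rfl⟩⟩, v, mem_univ _,
    by simpa [Y] using hv⟩
  obtain ⟨e, he, heS⟩ := exists_mem_notMem_of_card_lt_card (hS.trans_le hY)
  simp only [Y, mem_filter, mem_univ, true_and] at he
  obtain ⟨⟨p, hp⟩, hnot⟩ := he
  have hlast : (F.deleteEdges S).IsWalk (F.src e) [⟨e, heS⟩] (F.tgt e) := ⟨rfl, rfl⟩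
  exact hnot ⟨p ++ [⟨e, heS⟩], hp.append hlast⟩

theorem card_subtype_subtype (A : Finset E) (p : E → Prop) [DecidablePred p] :
    Nat.card {a : {e // e ∈ A} // p a} = #{e ∈ A | p e} := by
  rw [Nat.card_congr ((Equiv.subtypeSubtypeEquivSubtypeInter (fun e => e ∈ A) p).trans
    (Equiv.subtypeEquivRight fun e => (mem_filter (s := A) (p := p)).symm)),
    Nat.card_eq_fintype_card, Fintype.card_coe]

end MultiDigraph

open MultiDigraph in
theorem mainTheorem4 {V : Type u} {E : Type v} [Finite V] [Finite E] [Nonempty V]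
    (D : MultiDigraph V E) (r : ℕ) (hr : 1 ≤ r)
    (hsimple : D.IsSimple) (heuler : D.IsEulerian) (hdeg : ∀ x, r ≤ D.outDegree x) :
    ∃ (W : Type u) (A : Type v) (F : MultiDigraph W A),
      Finite W ∧ Finite A ∧
      D.Immerses F ∧ F.StronglyEdgeConnected r ∧ F.IsEulerian ∧ r < Nat.card W ∧
      ∃ S : Finset A, S.card < r ∧ (F.deleteEdges S).IsSimple := by
  classical
  have := Fintype.ofFinite V
  have := Fintype.ofFinite E
  have hbal : Balanced D.src D.tgt univ := fun v => by
    have := heuler v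
    rwa [inDegree, outDegree, Nat.card_eq_fintype_card, Nat.card_eq_fintype_card,
      Fintype.card_subtype, Fintype.card_subtype] at this
  obtain ⟨X, hne, hXr, hX⟩ := hbal.exists_inseparable hr
  have hcard : r < #X := lt_card_of_cutSize_lt hsimple (fun v => by
    have := hdeg v
    rwa [outDegree, Nat.card_eq_fintype_card, Fintype.card_subtype] at this) hne hXr
  have hinit : IsRouting D X r univ D.tgt (fun e => [e]) :=
    ⟨fun e _ => ⟨rfl, rfl⟩, fun e _ f _ hef => by simpa using hef.symm, hbal, hX, fun _ _ _ => rfl⟩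
  obtain ⟨A, t, P, hA, hin⟩ := hinit.exists_inside
  have hpath : ∀ a : {e // e ∈ A}, ∃ q, q ⊆ P a ∧ D.IsDirPath (D.src a) q (t a) := fun a =>
    (hA.isWalk a a.2).exists_isDirPath (hin a a.2).2.2
  choose Q hQP hQ using hpath
  let F : MultiDigraph {x // x ∈ X} {e // e ∈ A} :=
    ⟨fun a => ⟨D.src a, (hin a a.2).1⟩, fun a => ⟨t a, (hin a a.2).2.1⟩⟩
  refine ⟨{x // x ∈ X}, {e // e ∈ A}, F, inferInstance, inferInstance, ?_, ?_, ?_, ?_, ?_⟩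
  · refine ⟨Subtype.val, Q, Subtype.val_injective, hQ, fun a b hab x hxa hxb => ?_⟩
    exact hA.disjoint a a.2 b b.2 (fun h => hab (Subtype.ext h)) (hQP a hxa) (hQP b hxb)
  · refine stronglyEdgeConnected_of_le_cutSize fun Y hY => ?_
    obtain ⟨⟨a, -, haY⟩, b, -, hbY⟩ := hY
    refine (hA.le_cutSize (Y.map (.subtype _)) ⟨⟨a, a.2, by simpa using haY⟩,
      b, b.2, by simpa using hbY⟩).trans ?_
    refine (card_le_card fun e he => ?_).trans (card_image_le (f := Subtype.val))
    simp only [mem_filter, mem_map, Function.Embedding.subtype_apply, Subtype.exists,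
      exists_and_right, exists_eq_right, not_exists] at he
    obtain ⟨heA, ⟨_, hs⟩, ht⟩ := he
    exact mem_image.2 ⟨⟨e, heA⟩, by simpa [F] using ⟨hs, ht (hin e heA).2.1⟩, rfl⟩
  · intro v
    have h₁ := card_subtype_subtype A (fun e => t e = v)
    have h₂ := card_subtype_subtype A (fun e => D.src e = v)
    have h₃ := hA.balanced v
    rw [← h₁, ← h₂] at h₃
    simpa [inDegree, outDegree, F, Subtype.ext_iff] using h₃
  · simpa using hcard
  · refine ⟨({a | D.tgt a ∉ X} : Finset {e // e ∈ A}), ?_, ?_, ?_⟩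
    · refine lt_of_le_of_lt (card_le_card_of_injOn Subtype.val ?_ Subtype.val_injective.injOn) hXr
      intro a ha
      simpa using ⟨(hin a a.2).1, by simpa using ha⟩
    · intro a h
      exact (hin a.1 a.1.2).2.2 (congrArg Subtype.val h)
    · rintro ⟨a, ha⟩ ⟨b, hb⟩ hsrc htgt
      have ha' := hA.tgt_eq a a.2 (by simpa using ha)
      have hb' := hA.tgt_eq b b.2 (by simpa using hb)
      have hsrc' : D.src a = D.src b := congrArg Subtype.val hsrc
      have htgt' : t a = t b := congrArg Subtype.val htgt
      rw [ha', hb'] at htgt'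
      exact Subtype.ext (Subtype.ext (hsimple.2 _ _ hsrc' htgt'))
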